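/- Let $k$ be a field that is complete with respect to a (possibly trivial) non-Archimedean absolute value $|\cdot|$ and that is maximally complete, i.e. has no non-trivial immediate extension (no proper valued field extension with the same value group and the same residue field). Let $\mathbf{A}^{1}_{k}$ be the Berkovich affine line over $k$: the set of multiplicative seminorms on $k[T]$ extending $|\cdot|$, with the topology of pointwise convergence; write $|P(x)|$ for the value of the seminorm $x$ at $P\in k[T]$. For an irreducible polynomial $P\in k[T]$ let $\eta_{P,0}$ be the unique point with $P(\eta_{P,0})=0$ and, for a real number $r>0$, let $\eta_{P,r}$ be the unique point of the Shilov boundary of $\{x\in\mathbf{A}^1_k : |P(x)|\le r\}$. Let $D_0=\{\eta_{T,1}\}$ and, for every integer $d\ge 1$, let $$D_d=\{\eta_{P,r} : P\in k[T] \text{ irreducible of degree at most } d,\ r\ge 0\}.$$ Then for every $x\in\mathbf{A}^1_k$ and every integer $d\ge 0$ there is a unique point $x_d\in D_d$ such that $|P(x_d)|=|P(x)|$ for all $P\in k[T]$ of degree at most $d$, and the map $$\mathbf{A}^{1}_{k}\longrightarrow \varprojlim_{d\ge 0} D_d,\qquad x\longmapsto (x_d)_{d\ge 0},$$ is a bijection,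 where the transition maps of the inverse system are $D_{d'}\to D_d$, $y\mapsto y_d$, for $d\le d'$. -/

import Mathlib

open Polynomial

universe u

/-- A field `k` with a non-Archimedean absolute value is *maximally complete* if it has no
non-trivial immediate extension: every valued field extension `(L, v)` of `k` with the same value
group and the same residue field as `k` is equal to `k`. (An extension with the value group of `k`
is again real-valued, and a proper immediate extension in any universe contains, up to
isomorphism, one in the universe of `k`, namely `k(t)` for an element `t` outside `k`.) -/
def MaximallyComplete (k : Type u) [NormedField k] : Prop :=
  ∀ (L : Type u) [Field L] [Algebra k L] (v : AbsoluteValue L ℝ),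
    IsNonarchimedean v →
    (∀ a : k, v (algebraMap k L a) = ‖a‖) →
    -- same value group
    (∀ x : L, ∃ a : k, v x = ‖a‖) →
    -- same residue field: every residue class of the valuation ring of `L` is represented in `k`
    (∀ x : L, v x ≤ 1 → ∃ a : k, ‖a‖ ≤ 1 ∧ v (x - algebraMap k L a) < 1) →
    Function.Surjective (algebraMap k L)

/-- The Berkovich affine line over `k`: the multiplicative seminorms on `k[T]` that extend the
absolute value of `k`. -/
structure BerkovichLine (k : Type u) [NormedField k] extends MulRingSeminorm k[X] where
  map_C' : ∀ a : k, toFun (C a) = ‖a‖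

namespace BerkovichLine

variable {k : Type u} [NormedField k]

/-- The value `|P(x)|` of the polynomial `P` at the point `x`. -/
noncomputable def absAt (P : k[X]) (x : BerkovichLine k) : ℝ := x.toMulRingSeminorm P

/-- The topology of the Berkovich line: the coarsest one for which every map `x ↦ |P(x)|` is
continuous. -/
noncomputable instance : TopologicalSpace (BerkovichLine k) :=
  TopologicalSpace.induced (fun x (P : k[X]) => absAt P x) inferInstance

/-- The set `{|P| ≤ r}`. -/
def disc (P : k[X]) (r : ℝ) : Set (BerkovichLine k) := {x | absAt P x ≤ r}

/-- A boundary of `V`: a closed subset of `V` on which every function reaches its maximum over `V`.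
The functions are the polynomials; they are dense in the affinoid algebra of `{|P| ≤ r}`, which is
`k{r⁻¹S}[T]/(P(T) - S)`, hence for these domains the boundaries are those of the affinoid algebra. -/
def IsBoundary (V S : Set (BerkovichLine k)) : Prop :=
  IsClosed S ∧ S ⊆ V ∧ ∀ f : k[X], ∀ y ∈ V, ∃ z ∈ S, absAt f y ≤ absAt f z

/-- `S` is the Shilov boundary of `V`, that is, its smallest boundary. -/
def IsShilovBoundary (V S : Set (BerkovichLine k)) : Prop :=
  IsLeast {S' | IsBoundary V S'} S

/-- `x` is the point `η_{P,r}`: for `r = 0` the point where `P` vanishes, for `r > 0` the unique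
point of the Shilov boundary of `{|P| ≤ r}`. It is used for `P` irreducible and `r ≥ 0`. -/
def IsEta (P : k[X]) (r : ℝ) (x : BerkovichLine k) : Prop :=
  (r = 0 ∧ absAt P x = 0) ∨ (0 < r ∧ IsShilovBoundary (disc P r) {x})

variable (k) in
/-- The sets `D_d`: `D_0 = {η_{T,1}}`, and for `d ≥ 1` the set `D_d` consists of the points
`η_{P,r}`, where `P` is an irreducible polynomial of degree at most `d` and `r ≥ 0`. -/
def D : ℕ → Set (BerkovichLine k)
  | 0 => {x | IsEta X 1 x}
  | d + 1 => {x | ∃ P : k[X], Irreducible P ∧ P.natDegree ≤ d + 1 ∧ ∃ r : ℝ, 0 ≤ r ∧ IsEta P r x}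

/-- `x` and `y` give the same value to every polynomial of degree at most `d`. -/
def AgreeUpTo (d : ℕ) (x y : BerkovichLine k) : Prop :=
  ∀ P : k[X], P.natDegree ≤ d → absAt P y = absAt P x

end BerkovichLine

/-! The heart is the existence of `x_d`. For `d ≥ 1`, choose among the monic polynomials of positive
degree at most `d` one, `P`, minimizing `|P(x)|^(1 / deg P)`; with least degree among the minimizers
it is irreducible (`MaximallyComplete.exists_irreducible_forall_pow_le`). The minimum exists because
maximal completeness yields best approximations in finite-dimensional spaces of polynomials. Behind
this is Kaplansky's argument (`MaximallyComplete.exists_not_stableAlong`): a nested family of values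
approaching an unattained infimum would generate a proper immediate extension.

If `P(x) = 0`, take `x_d = x`. Otherwise extend `x` to the line over the algebraic closure and let
`α` be a root of `P` nearest to it, at distance `δ`. Comparing both expressions of the resultant of
`P` and a minimal polynomial `Q` shows that no element of degree at most `d` is nearer than `α`
(`MulRingSeminorm.map_X_sub_C_le_of_forall_pow_le`). Hence `x` and the disc of center `α` and radius
`δ` give the same value to every linear factor of a polynomial of degree at most `d`. Conjugating
the center shows that the disc point restricts to the largest point of a set `{|P| ≤ r}`
(`MaximallyComplete.exists_agree_maximal`), and a point is the whole Shilov boundary exactly when it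
is the largest (`BerkovichLine.isShilovBoundary_singleton_iff`).

Uniqueness (`BerkovichLine.eq_of_mem_D`) compares two largest points, or divides by a polynomial
vanishing at the point. The bijection is then formal: values are determined degree by degree, and
each seminorm axiom involves only finitely many polynomials
(`BerkovichLine.exists_forall_agreeUpTo`). -/

/-! ### Multiplicative seminorms and absolute values on fields. -/

/-- The fraction field of the quotient of a ring by the kernel of a multiplicative seminorm,
with the induced absolute value. -/
theorem MulRingSeminorm.exists_fractionField {R : Type u} [CommRing R] (s : MulRingSeminorm R) :
    ∃ (L : Type u) (_ : Field L) (φ : R →+* L) (v : AbsoluteValue L ℝ),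
      (∀ r, v (φ r) = s r) ∧ ∀ y, ∃ a b, φ b ≠ 0 ∧ y * φ b = φ a := by
  let I : Ideal R :=
    { carrier := {r | s r = 0}
      add_mem' := fun {a b} ha hb => le_antisymm
        ((map_add_le_add s a b).trans (by simp_all)) (apply_nonneg s _)
      zero_mem' := map_zero s
      smul_mem' := fun a b hb => by
        simp only [Set.mem_ofPred_eq, smul_eq_mul, map_mul] at hb ⊢
        rw [hb, mul_zero] }
  have hI : ∀ r, r ∈ I ↔ s r = 0 := fun r => Iff.rfl
  have : I.IsPrime := by
    refine ⟨fun h => ?_, fun {a b} hab => ?_⟩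
    · have : s 1 = 0 := (hI 1).1 (h ▸ Submodule.mem_top)
      simp at this
    · simpa [hI] using hab
  let L := FractionRing (R ⧸ I)
  let φ : R →+* L := (algebraMap (R ⧸ I) L).comp (Ideal.Quotient.mk I)
  have hφ0 : ∀ r, φ r = 0 ↔ s r = 0 := fun r => by
    simp only [φ, RingHom.comp_apply, FaithfulSMul.algebraMap_eq_zero_iff,
      Ideal.Quotient.eq_zero_iff_mem, hI]
  have hs : ∀ a b, φ a = φ b → s a = s b := fun a b h => by
    have h0 : s (a - b) = 0 := by rw [← hφ0, map_sub, h, sub_self]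
    refine le_antisymm ?_ ?_
    · have := map_add_le_add s (a - b) b
      simpa [h0] using this
    · have := map_add_le_add s (b - a) a
      rw [map_sub_rev, h0] at this
      simpa using this
  have hex : ∀ y : L, ∃ a b, φ b ≠ 0 ∧ y * φ b = φ a := fun y => by
    obtain ⟨a, b, hb, rfl⟩ := IsFractionRing.div_surjective (A := R ⧸ I) y
    obtain ⟨a, rfl⟩ := Ideal.Quotient.mk_surjective a
    obtain ⟨b, rfl⟩ := Ideal.Quotient.mk_surjective b
    have hb' : φ b ≠ 0 := IsFractionRing.to_map_ne_zero_of_mem_nonZeroDivisors (R := R ⧸ I) hb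
    exact ⟨a, b, hb', div_mul_cancel₀ _ hb'⟩
  choose num den hden hnum using hex
  have hpos : ∀ b, φ b ≠ 0 → 0 < s b := fun b hb =>
    lt_of_le_of_ne (apply_nonneg s b) fun h => hb ((hφ0 b).2 h.symm)
  -- The value does not depend on the chosen fraction, so each axiom can be checked on a convenient
  -- one.
  have key : ∀ y a b, φ b ≠ 0 → y * φ b = φ a → s (num y) / s (den y) = s a / s b := by
    intro y a b hb h
    rw [div_eq_div_iff (hpos _ (hden y)).ne' (hpos _ hb).ne', ← map_mul, ← map_mul]
    apply hs
    rw [map_mul, map_mul, ← h, ← hnum y]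
    ring
  refine ⟨L, inferInstance, φ,
    { toFun := fun y => s (num y) / s (den y)
      map_mul' := fun x y => ?_
      nonneg' := fun y => div_nonneg (apply_nonneg _ _) (apply_nonneg _ _)
      eq_zero' := fun y => ?_
      add_le' := fun x y => ?_ }, fun r => ?_, fun y => ⟨num y, den y, hden y, hnum y⟩⟩
  · rw [key (x * y) (num x * num y) (den x * den y)
      (by rw [map_mul]; exact mul_ne_zero (hden x) (hden y))
      (by rw [map_mul, map_mul, ← hnum, ← hnum]; ring), map_mul, map_mul, div_mul_div_comm]
  · rw [div_eq_zero_iff, or_iff_left (hpos _ (hden y)).ne', ← hφ0, ← hnum]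
    simp [hden y]
  · rw [key (x + y) (num x * den y + num y * den x) (den x * den y)
      (by rw [map_mul]; exact mul_ne_zero (hden x) (hden y))
      (by rw [map_mul, map_add, map_mul, map_mul, ← hnum, ← hnum]; ring),
      div_add_div _ _ (hpos _ (hden x)).ne' (hpos _ (hden y)).ne', map_mul]
    gcongr
    refine (map_add_le_add s _ _).trans ?_
    rw [map_mul, map_mul, mul_comm (s (num y))]
  · change s (num (φ r)) / s (den (φ r)) = s r
    rw [key (φ r) r 1 (by simp) (by simp)]
    simp

theorem AbsoluteValue.isNonarchimedean_of_natCast_le_one {L : Type*} [Field L]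
    (v : AbsoluteValue L ℝ) (h : ∀ n : ℕ, v n ≤ 1) : IsNonarchimedean v := by
  let := v.toNormedField
  have := IsUltrametricDist.isUltrametricDist_of_forall_norm_natCast_le_one (R := L) h
  exact fun a b => IsUltrametricDist.norm_add_le_max a b

theorem MulRingSeminorm.isNonarchimedean_of_natCast_le_one {R : Type*} [CommRing R]
    (s : MulRingSeminorm R) (h : ∀ n : ℕ, s n ≤ 1) : IsNonarchimedean s := by
  obtain ⟨L, _, φ, v, hv, -⟩ := s.exists_fractionField
  have := v.isNonarchimedean_of_natCast_le_one fun n => by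
    rw [← map_natCast φ, hv]
    exact h n
  intro a b
  simpa [← hv] using this (φ a) (φ b)

/-- The multiplicative seminorm obtained by composing an absolute value with a ring
homomorphism. -/
def AbsoluteValue.pullback {R L : Type*} [CommRing R] [Field L] (v : AbsoluteValue L ℝ)
    (φ : R →+* L) : MulRingSeminorm R where
  toFun r := v (φ r)
  map_zero' := by simp
  add_le' a b := by simpa using v.add_le (φ a) (φ b)
  neg' a := by simp
  map_one' := by simp
  map_mul' a b := by simp

@[simp]
theorem AbsoluteValue.pullback_apply {R L : Type*} [CommRing R] [Field L] (v : AbsoluteValue L ℝ)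
    (φ : R →+* L) (r : R) : v.pullback φ r = v (φ r) := rfl

/-! ### Extension of absolute values and of seminorms to algebraic extensions. -/

section Extension

variable {K : Type*} [NormedField K] {A : Type*} [Field A] [Algebra K A] [Algebra.IsAlgebraic K A]

/-- If `|a| > 1`, the leading term of the minimal polynomial at `a` would dominate all others. This
covers the trivially valued case, to which the spectral norm does not apply. -/
theorem AbsoluteValue.eq_one_of_norm_eq_one (hK : ∀ a : K, a ≠ 0 → ‖a‖ = 1)
    (v : AbsoluteValue A ℝ) (hna : IsNonarchimedean v) (hv : ∀ a : K, v (algebraMap K A a) = ‖a‖)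
    {a : A} (ha : a ≠ 0) : v a = 1 := by
  have hle : ∀ a : A, v a ≤ 1 := fun a => by
    by_contra! h
    have hm : (minpoly K a).Monic := minpoly.monic (Algebra.IsIntegral.isIntegral a)
    have h0 : aeval a (minpoly K a) = 0 := minpoly.aeval K a
    set p := minpoly K a
    rw [aeval_eq_sum_range, Finset.sum_range_succ, hm.coeff_natDegree, one_smul] at h0
    have h1 : v (a ^ p.natDegree) = v (∑ i ∈ Finset.range p.natDegree, p.coeff i • a ^ i) := by
      rw [eq_neg_of_add_eq_zero_right h0, v.map_neg]
    rcases Nat.eq_zero_or_pos p.natDegree with hn | hn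
    · rw [hn] at h1
      simp at h1
    · obtain ⟨i, hi, hle⟩ := IsNonarchimedean.finset_image_add_of_nonempty hna
        (fun i => p.coeff i • a ^ i) (Finset.nonempty_range_iff.2 hn.ne')
      rw [← h1, Algebra.smul_def, map_mul, hv, map_pow, map_pow] at hle
      have hlt : v a ^ i < v a ^ p.natDegree := pow_lt_pow_right₀ h (Finset.mem_range.1 hi)
      have hc : ‖p.coeff i‖ ≤ 1 := by
        by_cases hc : p.coeff i = 0
        · simp [hc]
        · exact (hK _ hc).le
      have : ‖p.coeff i‖ * v a ^ i ≤ 1 * v a ^ i := by gcongr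
      linarith
  refine le_antisymm (hle a) ?_
  have := hle a⁻¹
  rw [map_inv₀] at this
  exact (inv_le_one₀ (v.pos ha)).1 this

variable [CompleteSpace K]

theorem AbsoluteValue.eq_of_extends (v w : AbsoluteValue A ℝ) (hv : IsNonarchimedean v)
    (hw : IsNonarchimedean w) (hvK : ∀ a : K, v (algebraMap K A a) = ‖a‖)
    (hwK : ∀ a : K, w (algebraMap K A a) = ‖a‖) [IsUltrametricDist K] : v = w := by
  by_cases h : ∃ x : K, x ≠ 0 ∧ ‖x‖ ≠ 1
  · let := NontriviallyNormedField.ofNormNeOne h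
    ext a
    rw [spectralNorm_unique_field_norm_ext hvK, spectralNorm_unique_field_norm_ext hwK]
  · push Not at h
    ext a
    rcases eq_or_ne a 0 with rfl | ha
    · simp
    · rw [v.eq_one_of_norm_eq_one h hv hvK ha, w.eq_one_of_norm_eq_one h hw hwK ha]

variable (K A) in
theorem AbsoluteValue.exists_extends [IsUltrametricDist K] :
    ∃ v : AbsoluteValue A ℝ, IsNonarchimedean v ∧ ∀ a : K, v (algebraMap K A a) = ‖a‖ := by
  by_cases h : ∃ x : K, x ≠ 0 ∧ ‖x‖ ≠ 1
  · let := NontriviallyNormedField.ofNormNeOne h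
    let := spectralNorm.normedField K A
    exact ⟨NormedField.toAbsoluteValue A, isNonarchimedean_spectralNorm (K := K) (L := A),
      spectralNorm_extends (K := K) (L := A)⟩
  · push Not at h
    classical
    refine ⟨AbsoluteValue.trivial, fun a b => ?_, fun a => ?_⟩
    · by_cases hab : a + b = 0
      · rw [hab, map_zero]
        exact le_max_of_le_left (apply_nonneg _ _)
      · rw [AbsoluteValue.trivial_apply hab]
        by_cases ha : a = 0
        · have hb : b ≠ 0 := by rintro rfl; simp [ha] at hab
          rw [AbsoluteValue.trivial_apply hb]
          exact le_max_right _ _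
        · rw [AbsoluteValue.trivial_apply ha]
          exact le_max_left _ _
    · rcases eq_or_ne a 0 with rfl | ha
      · simp
      · rw [AbsoluteValue.trivial_apply (by simpa using ha), h a ha]

end Extension

theorem UniformSpace.Completion.isUltrametricDist (L : Type*) [NormedField L]
    [IsUltrametricDist L] : IsUltrametricDist (UniformSpace.Completion L) :=
  IsUltrametricDist.isUltrametricDist_of_forall_norm_natCast_le_one fun n => by
    have : ((n : L) : UniformSpace.Completion L) = n :=
      map_natCast (UniformSpace.Completion.coeRingHom (α := L)) n
    rw [← this, UniformSpace.Completion.norm_coe]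
    exact IsUltrametricDist.norm_natCast_le_one L n

/-- A multiplicative seminorm on `k[X]` extends to polynomials over an algebraic extension. -/
theorem MulRingSeminorm.exists_extends {k : Type u} [NormedField k] [IsUltrametricDist k]
    [CompleteSpace k] {A : Type u} [Field A] [Algebra k A] [Algebra.IsAlgebraic k A]
    (v : AbsoluteValue A ℝ) (hv : IsNonarchimedean v) (hvk : ∀ a : k, v (algebraMap k A a) = ‖a‖)
    (x : MulRingSeminorm k[X]) (hx : ∀ a, x (C a) = ‖a‖) :
    ∃ y : MulRingSeminorm A[X], IsNonarchimedean y ∧ (∀ a, y (C a) = v a) ∧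
      ∀ f : k[X], y (f.map (algebraMap k A)) = x f := by
  obtain ⟨L, _, φ, w, hw, -⟩ := x.exists_fractionField
  let := w.toNormedField
  have : IsUltrametricDist L :=
    IsUltrametricDist.isUltrametricDist_of_forall_norm_natCast_le_one fun n => by
      change w n ≤ 1
      rw [← map_natCast φ, hw, ← map_natCast C, hx]
      exact IsUltrametricDist.norm_natCast_le_one k n
  have := UniformSpace.Completion.isUltrametricDist L
  obtain ⟨u, hu, huL⟩ := AbsoluteValue.exists_extends (UniformSpace.Completion L)
    (AlgebraicClosure (UniformSpace.Completion L))
  let ψ : k[X] →+* AlgebraicClosure (UniformSpace.Completion L) :=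
    ((algebraMap _ _).comp UniformSpace.Completion.coeRingHom).comp φ
  have hψ : ∀ f, u (ψ f) = x f := fun f => by
    simp only [ψ, RingHom.comp_apply, huL]
    rw [← hw]
    exact UniformSpace.Completion.norm_coe (φ f)
  let : Algebra k (AlgebraicClosure (UniformSpace.Completion L)) := (ψ.comp C).toAlgebra
  let ι : A →ₐ[k] AlgebraicClosure (UniformSpace.Completion L) := IsAlgClosed.lift
  -- Any embedding will do: `k` is complete, so the extension of its absolute value to `A` is
  -- unique.
  have hι : ∀ a, u (ι a) = v a := fun a => by
    have := AbsoluteValue.eq_of_extends (K := k)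
      (u.comp (f := ι.toRingHom) ι.toRingHom.injective) v
      (fun a b => by
        have := hu (ι a) (ι b)
        rwa [← map_add] at this) hv
      (fun a => by
        change u (ι (algebraMap k A a)) = ‖a‖
        rw [ι.commutes, RingHom.algebraMap_toAlgebra, RingHom.comp_apply, hψ, hx]) hvk
    exact congrArg (fun w : AbsoluteValue A ℝ => w a) this
  refine ⟨u.pullback (eval₂RingHom (ι : A →+* _) (ψ X)), fun a b => ?_, fun a => ?_, fun f => ?_⟩
  · simpa using hu _ _
  · simpa using hι a
  · rw [AbsoluteValue.pullback_apply, ← hψ, coe_eval₂RingHom, eval₂_map]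
    congr 1
    have : (eval₂RingHom ((ι : A →+* _).comp (algebraMap k A)) (ψ X)) = ψ := by
      ext
      · simp [RingHom.algebraMap_toAlgebra]
      · simp
    exact congrArg (fun g : k[X] →+* _ => g f) this

/-! ### Seminorms that define immediate extensions. -/

section Immediate

variable {k : Type u} [NormedField k] [IsUltrametricDist k]

theorem MulRingSeminorm.isNonarchimedean_of_map_C (x : MulRingSeminorm k[X])
    (hx : ∀ a, x (C a) = ‖a‖) : IsNonarchimedean x :=
  x.isNonarchimedean_of_natCast_le_one fun n => by
    rw [← map_natCast C, hx]
    exact IsUltrametricDist.norm_natCast_le_one k n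

/-- Over a maximally complete field, a seminorm on `k[X]` for which all polynomials are close to
constants is the evaluation at a point of `k`. -/
theorem MaximallyComplete.exists_map_X_sub_C_eq_zero (hk : MaximallyComplete k)
    (x : MulRingSeminorm k[X]) (hx : ∀ a, x (C a) = ‖a‖)
    (h : ∀ f, x f ≠ 0 → ∃ a, x (f - C a) < x f) : ∃ c, x (X - C c) = 0 := by
  obtain ⟨L, _, φ, v, hv, hL⟩ := x.exists_fractionField
  let : Algebra k L := (φ.comp C).toAlgebra
  have halg : ∀ a : k, algebraMap k L a = φ (C a) := fun a => rfl
  have hna : IsNonarchimedean v := v.isNonarchimedean_of_natCast_le_one fun n => by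
    rw [← map_natCast φ, hv, ← map_natCast C, hx]
    exact IsUltrametricDist.norm_natCast_le_one k n
  have hnorm : ∀ (y : L) (c : k), v (y - algebraMap k L c) < v y → v y = ‖c‖ := fun y c hc => by
    have := IsNonarchimedean.add_eq_right_of_lt hna (x := algebraMap k L c - y) (y := y)
      (by rwa [v.map_sub])
    rw [sub_add_cancel, halg, hv, hx] at this
    exact this.symm
  have key : ∀ y : L, y ≠ 0 → ∃ c : k, v (y - algebraMap k L c) < v y := fun y hy => by
    obtain ⟨f, g, hg, hfg⟩ := hL y
    have hf : φ f ≠ 0 := hfg ▸ mul_ne_zero hy hg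
    have hf0 : 0 < v (φ f) := v.pos hf
    have hg0 : 0 < v (φ g) := v.pos hg
    obtain ⟨a, ha⟩ := h f (by rw [← hv]; exact hf0.ne')
    obtain ⟨b, hb⟩ := h g (by rw [← hv]; exact hg0.ne')
    rw [← hv, ← hv, map_sub, ← halg] at ha hb
    have hb' := hnorm _ _ hb
    have hbn : ‖b‖ ≠ 0 := hb' ▸ hg0.ne'
    have hvb : v (algebraMap k L b) = v (φ g) := by rw [halg, hv, hx, hb']
    have hva : v (algebraMap k L a) = v (φ f) := by rw [halg, hv, hx, hnorm _ _ ha]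
    have hbL : algebraMap k L b ≠ 0 := by rw [← v.ne_zero_iff, hvb]; exact hg0.ne'
    refine ⟨a / b, ?_⟩
    -- Writing `y = f / g` with `f` close to `a` and `g` close to `b`, the quotient `a / b` is close
    -- to `y`.
    have e : (y - algebraMap k L (a / b)) * (φ g * algebraMap k L b) =
        (φ f - algebraMap k L a) * algebraMap k L b +
          algebraMap k L a * (algebraMap k L b - φ g) := by
      rw [map_div₀, sub_mul, ← mul_assoc, hfg]
      field_simp
      ring
    have hlt : v ((y - algebraMap k L (a / b)) * (φ g * algebraMap k L b)) <
        v (φ f) * v (φ g) := by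
      rw [e]
      refine (hna _ _).trans_lt (max_lt ?_ ?_)
      · rw [map_mul, hvb]
        gcongr
      · rw [map_mul, hva, v.map_sub]
        gcongr
    rw [← hfg, map_mul, map_mul, map_mul, hvb, ← mul_assoc] at hlt
    exact lt_of_mul_lt_mul_right (lt_of_mul_lt_mul_right hlt hg0.le) hg0.le
  obtain ⟨c, hc⟩ := hk L v hna (fun a => by rw [halg, hv, hx])
    (fun y => by
      rcases eq_or_ne y 0 with rfl | hy
      · exact ⟨0, by simp⟩
      · obtain ⟨c, hc⟩ := key y hy
        exact ⟨c, hnorm y c hc⟩)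
    (fun y hy1 => by
      rcases eq_or_ne y 0 with rfl | hy
      · exact ⟨0, by simp⟩
      · obtain ⟨c, hc⟩ := key y hy
        exact ⟨c, hnorm y c hc ▸ hy1, hc.trans_le hy1⟩) (φ X)
  exact ⟨c, by rw [← hv, map_sub, ← halg, hc, sub_self, map_zero]⟩

end Immediate

/-! ### Polynomials with stable values along a filter. -/

namespace Polynomial

variable {k : Type u} [NormedField k]

/-- All values of `f` on some set of the filter `l` are nonzero and equivalent to each other. -/
def StableAlong (l : Filter k) (f : k[X]) : Prop :=
  ∃ s ∈ l, ∀ a ∈ s, ∀ b ∈ s, ‖f.eval a - f.eval b‖ < ‖f.eval b‖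

/-- The limit of `‖f a‖` along `l`. -/
noncomputable def normAlong (l : Filter k) (f : k[X]) : ℝ := l.limUnder fun a => ‖f.eval a‖

variable {l : Filter k} {f g : k[X]}

theorem normAlong_eq [l.NeBot] {r : ℝ} (h : ∀ᶠ a in l, ‖f.eval a‖ = r) : normAlong l f = r :=
  (tendsto_const_nhds.congr' (h.mono fun _ ha => ha.symm)).limUnder_eq

theorem StableAlong.C {c : k} (hc : c ≠ 0) : StableAlong l (C c) :=
  ⟨Set.univ, Filter.univ_mem, fun a _ b _ => by simpa using hc⟩

variable [IsUltrametricDist k]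

theorem norm_sub_le_max' (a b : k) : ‖a - b‖ ≤ max ‖a‖ ‖b‖ := by
  simpa [sub_eq_add_neg] using IsUltrametricDist.norm_add_le_max a (-b)

theorem norm_eq_of_norm_sub_lt {a b : k} (h : ‖a - b‖ < ‖b‖) : ‖a‖ = ‖b‖ := by
  have := IsUltrametricDist.norm_add_eq_max_of_norm_ne_norm (x := a - b) (y := b) h.ne
  rwa [sub_add_cancel, max_eq_right h.le] at this

theorem StableAlong.exists_norm_eq [l.NeBot] (h : StableAlong l f) :
    ∃ r, 0 < r ∧ ∀ᶠ a in l, ‖f.eval a‖ = r := by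
  obtain ⟨s, hs, h⟩ := h
  obtain ⟨b, hb⟩ := l.nonempty_of_mem hs
  exact ⟨‖f.eval b‖, (norm_nonneg _).trans_lt (h b hb b hb),
    Filter.mem_of_superset hs fun a ha => norm_eq_of_norm_sub_lt (h a ha b hb)⟩

theorem StableAlong.mul (hf : StableAlong l f) (hg : StableAlong l g) : StableAlong l (f * g) := by
  obtain ⟨s, hs, hf⟩ := hf
  obtain ⟨t, ht, hg⟩ := hg
  refine ⟨s ∩ t, Filter.inter_mem hs ht, fun a ha b hb => ?_⟩
  have h1 := hf a ha.1 b hb.1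
  have h2 := hg a ha.2 b hb.2
  have e : (f * g).eval a - (f * g).eval b =
      (f.eval a - f.eval b) * g.eval a + f.eval b * (g.eval a - g.eval b) := by
    rw [eval_mul, eval_mul]
    ring
  rw [e]
  refine (IsUltrametricDist.norm_add_le_max _ _).trans_lt (max_lt ?_ ?_)
  · rw [norm_mul, norm_eq_of_norm_sub_lt h2, eval_mul, norm_mul]
    have := (norm_nonneg _).trans_lt h2
    gcongr
  · rw [norm_mul, eval_mul, norm_mul]
    have := (norm_nonneg _).trans_lt h1
    gcongr

/-- Stability says that the ratios of values lie in `1 + 𝔪`, where `𝔪` is the maximal ideal of the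
valuation ring; this group is closed under division. -/
theorem StableAlong.of_mul_left (h : StableAlong l (f * g)) (hf : StableAlong l f) :
    StableAlong l g := by
  obtain ⟨s, hs, hf⟩ := hf
  obtain ⟨t, ht, h⟩ := h
  refine ⟨s ∩ t, Filter.inter_mem hs ht, fun a ha b hb => ?_⟩
  have h1 := hf a ha.1 b hb.1
  have h2 := h a ha.2 b hb.2
  have h0 := (norm_nonneg _).trans_lt h1
  have hg0 : 0 < ‖g.eval b‖ := by
    have := (norm_nonneg _).trans_lt h2
    rw [eval_mul, norm_mul] at this
    exact pos_of_mul_pos_right this h0.le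
  have e : f.eval a * (g.eval a - g.eval b) =
      ((f * g).eval a - (f * g).eval b) - (f.eval a - f.eval b) * g.eval b := by
    rw [eval_mul, eval_mul]
    ring
  have : ‖f.eval a * (g.eval a - g.eval b)‖ < ‖f.eval b‖ * ‖g.eval b‖ := by
    rw [e]
    refine (norm_sub_le_max' _ _).trans_lt (max_lt ?_ ?_)
    · rwa [← norm_mul, ← eval_mul]
    · rw [norm_mul]
      gcongr
  rw [norm_mul, norm_eq_of_norm_sub_lt h1] at this
  exact lt_of_mul_lt_mul_left this h0.le

end Polynomial

/-! ### Kaplansky's argument: maximal completeness excludes pseudo-limits outside `k`. -/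

section Spherical

variable {k : Type u} [NormedField k] [IsUltrametricDist k] {l : Filter k}

/-- Applied with `ρ` the identity or the reduction modulo a monic polynomial, the cases of a
transcendental or algebraic pseudo-limit. The limit of `|ρ f|` along `l` is a multiplicative
seminorm in `f`, and by stability `f` is close to the constant `(ρ f).eval a` for suitable `a`, so
the extension defined is immediate. -/
theorem MaximallyComplete.exists_map_linear_eq_zero (hk : MaximallyComplete k) [l.NeBot]
    (ρ : k[X] →ₗ[k] k[X]) (h1 : ρ 1 = 1) (hst : ∀ f, ρ f ≠ 0 → (ρ f).StableAlong l)
    (hmul : ∀ f g, ∀ᶠ a in l, ‖(ρ (f * g)).eval a‖ = ‖(ρ f).eval a‖ * ‖(ρ g).eval a‖) :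
    ∃ c, ρ (X - C c) = 0 := by
  have hC : ∀ a, ρ (C a) = C a := fun a => by
    rw [← mul_one (C a), ← smul_eq_C_mul, map_smul, h1]
  have hev : ∀ f, ∀ᶠ a in l, ‖(ρ f).eval a‖ = normAlong l (ρ f) := fun f => by
    by_cases hf : ρ f = 0
    · have h0 : ∀ᶠ a in l, ‖(ρ f).eval a‖ = 0 := Filter.Eventually.of_forall fun a => by simp [hf]
      rwa [normAlong_eq h0]
    · obtain ⟨r, -, hr⟩ := (hst f hf).exists_norm_eq
      rwa [normAlong_eq hr]
  let x : MulRingSeminorm k[X] :=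
    { toFun := fun f => normAlong l (ρ f)
      map_zero' := normAlong_eq (Filter.Eventually.of_forall fun a => by simp)
      add_le' := fun f g => by
        obtain ⟨a, hf, hg, hfg⟩ := ((hev f).and ((hev g).and (hev (f + g)))).exists
        rw [← hf, ← hg, ← hfg, map_add, eval_add]
        exact norm_add_le _ _
      neg' := fun f => by simp only [normAlong, map_neg, eval_neg, norm_neg]
      map_one' := normAlong_eq (Filter.Eventually.of_forall fun a => by simp [h1])
      map_mul' := fun f g => by
        obtain ⟨a, hf, hg, hfg, h⟩ :=
          ((hev f).and ((hev g).and ((hev (f * g)).and (hmul f g)))).exists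
        rw [← hf, ← hg, ← hfg, h] }
  have hxdef : ∀ f, x f = normAlong l (ρ f) := fun f => rfl
  have hpos : ∀ f, ρ f ≠ 0 → x f ≠ 0 := fun f hf => by
    obtain ⟨r, hr0, hr⟩ := (hst f hf).exists_norm_eq
    rw [hxdef, normAlong_eq hr]
    exact hr0.ne'
  obtain ⟨c, hc⟩ := hk.exists_map_X_sub_C_eq_zero x
    (fun a => normAlong_eq (Filter.Eventually.of_forall fun b => by simp [hC]))
    (fun f hf => by
      have hf0 : ρ f ≠ 0 := fun h => hf (by rw [hxdef, h, ← map_zero ρ, ← hxdef, map_zero])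
      obtain ⟨s, hs, h⟩ := hst f hf0
      obtain ⟨a, ha⟩ := l.nonempty_of_mem hs
      refine ⟨(ρ f).eval a, ?_⟩
      obtain ⟨b, hb, h2, h3⟩ :=
        (Filter.Eventually.and hs ((hev f).and (hev (f - C ((ρ f).eval a))))).exists
      rw [hxdef, hxdef, ← h2, ← h3, map_sub, hC, eval_sub, eval_C, norm_sub_rev]
      exact h a ha b hb)
  exact ⟨c, by by_contra h; exact hpos _ h hc⟩

/-- Over a maximally complete field, no filter is such that all linear polynomials have
equivalent values along it. -/
theorem MaximallyComplete.exists_not_stableAlong (hk : MaximallyComplete k) (l : Filter k)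
    [l.NeBot] : ∃ c : k, ¬ (X - C c : k[X]).StableAlong l := by
  by_contra! hlin
  by_cases hall : ∀ f : k[X], f ≠ 0 → f.StableAlong l
  · obtain ⟨c, hc⟩ := hk.exists_map_linear_eq_zero (l := l) LinearMap.id rfl hall
      (fun f g => Filter.Eventually.of_forall fun a => by simp)
    exact X_sub_C_ne_zero c hc
  push Not at hall
  -- An unstable `q` of least degree plays the role of the minimal polynomial of the pseudo-limit.
  obtain ⟨q, ⟨hq0, hq⟩, hmin⟩ := exists_minimalFor_of_wellFoundedLT
    (fun f : k[X] => f ≠ 0 ∧ ¬ f.StableAlong l) natDegree hall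
  wlog hm : q.Monic generalizing q
  · have hc : q.leadingCoeff⁻¹ ≠ 0 := inv_ne_zero (leadingCoeff_ne_zero.2 hq0)
    refine this (C q.leadingCoeff⁻¹ * q) (fun f hf => ?_) (mul_ne_zero (C_ne_zero.2 hc) hq0)
      (fun h => hq (StableAlong.of_mul_left h (StableAlong.C hc))) ?_
    · rw [natDegree_C_mul hc]
      exact hmin hf
    · rw [Monic, leadingCoeff_mul, leadingCoeff_C,
        inv_mul_cancel₀ (leadingCoeff_ne_zero.2 hq0)]
  have hstab : ∀ f : k[X], f ≠ 0 → f.natDegree < q.natDegree → f.StableAlong l := fun f h0 hd => by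
    by_contra h
    exact absurd (hmin ⟨h0, h⟩ hd.le) hd.not_ge
  have hdeg1 : 1 < q.natDegree := by
    by_contra! h
    rcases Nat.le_one_iff_eq_zero_or_eq_one.1 h with h | h
    · rw [hm.natDegree_eq_zero.1 h, ← C_1] at hq
      exact hq (StableAlong.C one_ne_zero)
    · have := hm.eq_X_add_C h
      rw [this, ← sub_neg_eq_add, ← C_neg] at hq
      exact hq (hlin _)
  have hq1 : q ≠ 1 := by rintro rfl; simp at hdeg1
  have hmod : ∀ f, (f %ₘ q).natDegree < q.natDegree := fun f => natDegree_modByMonic_lt f hm hq1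
  obtain ⟨c, hc⟩ := hk.exists_map_linear_eq_zero (l := l) (modByMonicHom q)
    ((modByMonic_eq_self_iff hm).2 (by
      rw [degree_one, degree_eq_natDegree hq0]
      exact_mod_cast one_pos.trans hdeg1))
    (fun f hf => hstab _ hf (hmod f)) (fun f g => by
      simp only [modByMonicHom_apply]
      set F := f %ₘ q
      set G := g %ₘ q
      have hfg : (f * g) %ₘ q = (F * G) %ₘ q := mul_modByMonic f g q
      rw [hfg]
      by_cases hF : F = 0
      · exact Filter.Eventually.of_forall fun a => by simp [hF]
      by_cases hG : G = 0
      · exact Filter.Eventually.of_forall fun a => by simp [hG]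
      have hFG : (F * G).StableAlong l := (hstab F hF (hmod f)).mul (hstab G hG (hmod g))
      have hdiv := modByMonic_add_div (F * G) q
      set r := (F * G) %ₘ q
      set h := (F * G) /ₘ q with h_def
      simp only [← norm_mul, ← eval_mul]
      by_cases hh : h = 0
      · rw [hh, mul_zero, add_zero] at hdiv
        exact Filter.Eventually.of_forall fun a => by rw [hdiv]
      -- The quotient has degree at most `deg F + deg G - deg q < deg q`, hence is stable. Stability
      -- of `h * q` would therefore pass to `q`.
      have hhst : h.StableAlong l := hstab h hh (by
        rw [h_def, natDegree_divByMonic _ hm, natDegree_mul hF hG]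
        have : F.natDegree < q.natDegree := hmod f
        have : G.natDegree < q.natDegree := hmod g
        omega)
      by_cases hr : r = 0
      · rw [hr, zero_add, mul_comm] at hdiv
        exact absurd ((hdiv ▸ hFG).of_mul_left hhst) hq
      obtain ⟨s, hs, h1⟩ := hFG
      obtain ⟨t, ht, h2⟩ := hstab r hr (hmod _)
      refine Filter.mem_of_superset (Filter.inter_mem hs ht) fun a ha => ?_
      by_contra hne
      refine hq (StableAlong.of_mul_left (f := h) ⟨s ∩ t, Filter.inter_mem hs ht,
        fun b hb c hc => ?_⟩ hhst)
      have e : ∀ b, (h * q).eval b = (F * G).eval b - r.eval b := fun b => by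
        rw [← hdiv, eval_add, mul_comm, add_sub_cancel_left]
      have n1 : ∀ b ∈ s ∩ t, ‖(F * G).eval b‖ = ‖(F * G).eval a‖ := fun b hb =>
        norm_eq_of_norm_sub_lt (h1 b hb.1 a ha.1)
      have n2 : ∀ b ∈ s ∩ t, ‖r.eval b‖ = ‖r.eval a‖ := fun b hb =>
        norm_eq_of_norm_sub_lt (h2 b hb.2 a ha.2)
      -- If `F * G` and its remainder had different norms, nothing would cancel in `h * q = F * G -
      -- r`, which would then be stable.
      have hqc : ‖(h * q).eval c‖ = max ‖(F * G).eval c‖ ‖r.eval c‖ := by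
        rw [e]
        rw [sub_eq_add_neg, ← norm_neg (r.eval c)]
        apply IsUltrametricDist.norm_add_eq_max_of_norm_ne_norm
        rw [norm_neg, n1 c hc, n2 c hc]
        exact Ne.symm hne
      rw [hqc, e, e, sub_sub_sub_comm]
      exact (norm_sub_le_max' _ _).trans_lt
        (max_lt_max (h1 b hb.1 c hc.1) (h2 b hb.2 c hc.2)))
  rw [modByMonicHom_apply, (modByMonic_eq_self_iff hm).2] at hc
  · exact X_sub_C_ne_zero c hc
  · rw [degree_X_sub_C, degree_eq_natDegree hq0]
    exact_mod_cast hdeg1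

end Spherical

/-! ### Best approximation and polynomials of least value. -/

section Minimizer

variable {k : Type u} [NormedField k] [IsUltrametricDist k]

/-- A function on a maximally complete field that behaves like the distance to a point of a
one-dimensional seminormed space attains its infimum. -/
theorem MaximallyComplete.exists_forall_le (hk : MaximallyComplete k) (φ : k → ℝ) {m : ℝ}
    (hm : 0 ≤ m) (h1 : ∀ a b, φ a ≤ max (φ b) (‖a - b‖ * m))
    (h2 : ∀ a b, ‖a - b‖ * m ≤ max (φ a) (φ b)) : ∃ b, ∀ a, φ b ≤ φ a := by
  by_contra! hinf
  -- The nested sublevel sets of `φ`. If the infimum is not attained, each `c` is left out of one of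
  -- them, and this makes `X - C c` stable.
  let l : Filter k := ⨅ a, Filter.principal {b | φ b ≤ φ a}
  have hmem : ∀ a, {b | φ b ≤ φ a} ∈ l := fun a =>
    Filter.mem_iInf_of_mem a (Filter.mem_principal_self _)
  have : l.NeBot := by
    refine Filter.iInf_neBot_of_directed (fun a b => ?_)
      fun a => Filter.principal_neBot_iff.2 ⟨a, le_refl (φ a)⟩
    rcases le_total (φ a) (φ b) with h | h
    · exact ⟨a, le_rfl, Filter.principal_mono.2 fun c hc => le_trans hc h⟩
    · exact ⟨b, Filter.principal_mono.2 fun c hc => le_trans hc h, le_rfl⟩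
  obtain ⟨c, hc⟩ := hk.exists_not_stableAlong l
  obtain ⟨a, ha⟩ := hinf c
  refine hc ⟨_, hmem a, fun b hb b' hb' => ?_⟩
  simp only [eval_sub, eval_X, eval_C, sub_sub_sub_cancel_right]
  have hlt : ‖b - b'‖ * m < ‖b' - c‖ * m := by
    refine ((h2 b b').trans (max_le hb hb')).trans_lt (ha.trans_le ?_)
    rw [norm_sub_rev]
    exact (le_max_iff.1 (h1 c b')).resolve_left (hb'.trans_lt ha).not_ge
  exact lt_of_mul_lt_mul_right hlt hm

variable (x : MulRingSeminorm k[X])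

/-- Induction on the dimension of the approximating space: one new direction at a time reduces the
problem to a function of one scalar, minimized by `MaximallyComplete.exists_forall_le`. -/
theorem MaximallyComplete.exists_degree_lt_forall_le (hk : MaximallyComplete k)
    (hx : ∀ a, x (C a) = ‖a‖) (e : ℕ) (v : k[X]) :
    ∃ w : k[X], w.degree < e ∧ ∀ u : k[X], u.degree < e → x (v + w) ≤ x (v + u) := by
  have hna := x.isNonarchimedean_of_map_C hx
  induction e generalizing v with
  | zero =>
    refine ⟨0, by simp, fun u hu => ?_⟩
    rw [show u = 0 by simpa using hu]
  | succ e ih =>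
    -- The new direction is not `X ^ e` but `P`, made orthogonal to the polynomials of degree below
    -- `e`; the second inequality required of `φ` rests on this.
    obtain ⟨w₀, hw₀, hP⟩ := ih (X ^ e)
    set P := X ^ e + w₀ with P_def
    have hP' : ∀ u : k[X], u.degree < e → x P ≤ x (P + u) := fun u hu => by
      rw [P_def, add_assoc]
      exact hP _ ((degree_add_le _ _).trans_lt (max_lt hw₀ hu))
    choose w hw hmin using fun a => ih (v + C a * P)
    obtain ⟨b, hb⟩ := hk.exists_forall_le (fun a => x (v + C a * P + w a)) (apply_nonneg x P)
      (fun a b => by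
        refine (hmin a (w b) (hw b)).trans ?_
        rw [show v + C a * P + w b = (v + C b * P + w b) + C (a - b) * P by
          rw [C_sub]; ring, ← hx, ← map_mul]
        exact hna _ _)
      (fun a b => by
        rcases eq_or_ne a b with rfl | hab
        · simp
        have hab' : a - b ≠ 0 := sub_ne_zero.2 hab
        have h := hP' (C (a - b)⁻¹ * (w a - w b)) (by
          rw [degree_C_mul (inv_ne_zero hab')]
          exact (degree_sub_le _ _).trans_lt (max_lt (hw a) (hw b)))
        have e : C (a - b) * (P + C (a - b)⁻¹ * (w a - w b)) =
            (v + C a * P + w a) + -(v + C b * P + w b) := by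
          rw [mul_add, ← mul_assoc, ← C_mul, mul_inv_cancel₀ hab', C_1, C_sub]
          ring
        calc ‖a - b‖ * x P ≤ ‖a - b‖ * x (P + C (a - b)⁻¹ * (w a - w b)) := by gcongr
          _ = x ((v + C a * P + w a) + -(v + C b * P + w b)) := by rw [← e, map_mul, hx]
          _ ≤ _ := by
            have := hna (v + C a * P + w a) (-(v + C b * P + w b))
            rwa [map_neg_eq_map] at this)
    have hPc : P.coeff e = 1 := by
      rw [P_def, coeff_add, coeff_X_pow_self, coeff_eq_zero_of_degree_lt hw₀, add_zero]
    have hPdeg : P.degree < ((e + 1 : ℕ) : WithBot ℕ) := by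
      refine (degree_add_le _ _).trans_lt (max_lt ?_ (hw₀.trans (by exact_mod_cast e.lt_succ_self)))
      rw [degree_X_pow]
      exact_mod_cast e.lt_succ_self
    have hCP : ∀ a, (C a * P).degree < ((e + 1 : ℕ) : WithBot ℕ) := fun a => by
      rw [← smul_eq_C_mul]
      exact (degree_smul_le a P).trans_lt hPdeg
    refine ⟨C b * P + w b, ?_, fun u hu => ?_⟩
    · exact (degree_add_le _ _).trans_lt
        (max_lt (hCP b) ((hw b).trans (by exact_mod_cast e.lt_succ_self)))
    · rw [← add_assoc]
      refine (hb (u.coeff e)).trans ?_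
      rw [show v + u = v + C (u.coeff e) * P + (u - C (u.coeff e) * P) by ring]
      refine hmin _ _ ((degree_lt_iff_coeff_zero _ _).2 fun i hi => ?_)
      rcases hi.eq_or_lt with rfl | hi
      · simp [hPc]
      · exact (degree_lt_iff_coeff_zero _ _).1
          ((degree_sub_le _ _).trans_lt (max_lt hu (hCP _))) i hi

theorem MaximallyComplete.exists_monic_forall_le (hk : MaximallyComplete k)
    (hx : ∀ a, x (C a) = ‖a‖) (e : ℕ) :
    ∃ P : k[X], P.Monic ∧ P.natDegree = e ∧
      ∀ Q : k[X], Q.Monic → Q.natDegree = e → x P ≤ x Q := by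
  obtain ⟨w, hw, h⟩ := hk.exists_degree_lt_forall_le x hx e (X ^ e)
  refine ⟨X ^ e + w, monic_X_pow_add hw, natDegree_eq_of_degree_eq_some ?_, fun Q hQ hd => ?_⟩
  · rw [degree_add_eq_left_of_degree_lt (by rwa [degree_X_pow]), degree_X_pow]
  · have := h (Q - X ^ e) (by
      rw [← hd, ← degree_eq_natDegree hQ.ne_zero]
      exact degree_sub_lt_left (by rw [degree_X_pow, degree_eq_natDegree hQ.ne_zero]) hQ.ne_zero
        (by rw [hQ.leadingCoeff, (monic_X_pow _).leadingCoeff]))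
    rwa [add_sub_cancel] at this

/-- Among the polynomials of positive degree at most `d`, some irreducible one has the smallest
value relative to its degree. -/
theorem MaximallyComplete.exists_irreducible_forall_pow_le (hk : MaximallyComplete k)
    (hx : ∀ a, x (C a) = ‖a‖) {d : ℕ} (hd : 1 ≤ d) :
    ∃ P : k[X], P.Monic ∧ Irreducible P ∧ P.natDegree ≤ d ∧
      ∀ Q : k[X], Q.Monic → 0 < Q.natDegree → Q.natDegree ≤ d →
        x P ^ Q.natDegree ≤ x Q ^ P.natDegree := by
  choose M hM hMd hMin using hk.exists_monic_forall_le x hx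
  let w : k[X] → ℝ := fun Q => x Q ^ ((Q.natDegree : ℝ)⁻¹)
  have hw0 : ∀ Q, 0 ≤ w Q := fun Q => Real.rpow_nonneg (apply_nonneg x Q) _
  have hw : ∀ Q, 0 < Q.natDegree → w Q ^ Q.natDegree = x Q := fun Q hQ =>
    Real.rpow_inv_natCast_pow (apply_nonneg x Q) hQ.ne'
  let good : k[X] → Prop := fun P => (P.Monic ∧ 0 < P.natDegree ∧ P.natDegree ≤ d) ∧
    ∀ Q : k[X], Q.Monic → 0 < Q.natDegree → Q.natDegree ≤ d → w P ≤ w Q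
  have hgood : ∃ P, good P := by
    obtain ⟨e, he, hmin⟩ := Finset.exists_min_image (Finset.Icc 1 d) (fun e => w (M e))
      ⟨1, Finset.mem_Icc.2 ⟨le_rfl, hd⟩⟩
    rw [Finset.mem_Icc] at he
    refine ⟨M e, ⟨hM e, by rw [hMd]; exact he.1, by rw [hMd]; exact he.2⟩,
      fun Q hQ h1 h2 => (hmin Q.natDegree (Finset.mem_Icc.2 ⟨h1, h2⟩)).trans ?_⟩
    simp only [w, hMd]
    exact Real.rpow_le_rpow (apply_nonneg _ _) (hMin _ Q hQ rfl) (by positivity)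
  obtain ⟨P, ⟨⟨hPm, hP0, hPd⟩, hP⟩, hmin⟩ :=
    exists_minimalFor_of_wellFoundedLT good natDegree hgood
  refine ⟨P, hPm, ?_, hPd, fun Q hQ h1 h2 => ?_⟩
  · refine hPm.irreducible_iff_natDegree.2 ⟨by rintro rfl; simp at hP0, fun A B hA hB hAB => ?_⟩
    by_contra! hne
    have hdeg : A.natDegree + B.natDegree = P.natDegree := by
      rw [← hAB, hA.natDegree_mul hB]
    have hlt : ∀ A : k[X], A.Monic → 0 < A.natDegree → A.natDegree < P.natDegree →
        w P < w A := fun A hA h0 hlt => by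
      by_contra! hle
      exact absurd (hmin ⟨⟨hA, h0, hlt.le.trans hPd⟩,
        fun Q hQ h1 h2 => hle.trans (hP Q hQ h1 h2)⟩ hlt.le) hlt.not_ge
    have hA' := hlt A hA (by omega) (by omega)
    have hB' := hlt B hB (by omega) (by omega)
    -- Both factors have smaller degree, so by the choice of `P` their weights are strictly larger;
    -- this contradicts multiplicativity.
    have : w P ^ P.natDegree < w A ^ A.natDegree * w B ^ B.natDegree := by
      rw [← hdeg, pow_add]
      exact mul_lt_mul'' (pow_lt_pow_left₀ hA' (hw0 P) (by omega))
        (pow_lt_pow_left₀ hB' (hw0 P) (by omega)) (pow_nonneg (hw0 P) _) (pow_nonneg (hw0 P) _)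
    rw [hw _ hP0, hw _ (by omega), hw _ (by omega), ← map_mul, hAB] at this
    exact lt_irrefl _ this
  · rw [← hw P hP0, ← hw Q h1, ← pow_mul, ← pow_mul, mul_comm]
    exact pow_le_pow_left₀ (hw0 P) (hP Q hQ h1 h2) _

end Minimizer

theorem Multiset.prod_map_lt_prod_map_of_exists {α : Type*} {s : Multiset α} {f g : α → ℝ}
    (h0 : ∀ a ∈ s, 0 ≤ f a) (hle : ∀ a ∈ s, f a ≤ g a) (hpos : ∀ a ∈ s, 0 < g a)
    (hlt : ∃ a ∈ s, f a < g a) : (s.map f).prod < (s.map g).prod := by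
  obtain ⟨a, ha, hlt⟩ := hlt
  obtain ⟨t, rfl⟩ := Multiset.exists_cons_of_mem ha
  simp only [Multiset.mem_cons, forall_eq_or_imp] at h0 hle hpos
  rw [Multiset.map_cons, Multiset.map_cons, Multiset.prod_cons, Multiset.prod_cons]
  refine mul_lt_mul_of_lt_of_le_of_nonneg_of_pos hlt
    (Multiset.prod_map_le_prod_map₀ f g h0.2 hle.2) h0.1 (Multiset.prod_pos fun r hr => ?_)
  obtain ⟨b, hb, rfl⟩ := Multiset.mem_map.1 hr
  exact hpos.2 b hb

/-! ### Distances to roots in an algebraic closure. -/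

section Roots

variable {k A : Type*} [Field k] [Field A] [Algebra k A]
  {v : AbsoluteValue A ℝ}

theorem Irreducible.exists_algEquiv_eq [Normal k A] {P : k[X]} (hP : Irreducible P) {a b : A}
    (ha : a ∈ P.aroots A) (hb : b ∈ P.aroots A) : ∃ σ : A ≃ₐ[k] A, σ a = b := by
  rw [mem_aroots] at ha hb
  refine minpoly.exists_algEquiv_of_root (Algebra.IsAlgebraic.isAlgebraic b) ?_
  rw [← minpoly.eq_of_irreducible hP hb.2, map_mul, ha.2, zero_mul]

theorem AlgEquiv.map_mem_aroots (σ : A ≃ₐ[k] A) {P : k[X]} {a : A} (ha : a ∈ P.aroots A) :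
    σ a ∈ P.aroots A := by
  rw [mem_aroots] at ha ⊢
  exact ⟨ha.1, by rw [aeval_algEquiv, AlgHom.comp_apply, ha.2]; simp⟩

theorem AbsoluteValue.map_aeval_eq_of_mem_aroots [Normal k A]
    (hσ : ∀ (σ : A ≃ₐ[k] A) a, v (σ a) = v a) {P : k[X]} (hP : Irreducible P) {a b : A}
    (ha : a ∈ P.aroots A) (hb : b ∈ P.aroots A) (f : k[X]) : v (aeval a f) = v (aeval b f) := by
  obtain ⟨σ, rfl⟩ := hP.exists_algEquiv_eq ha hb
  rw [← hσ σ (aeval a f), ← AlgEquiv.coe_toAlgHom, ← aeval_algHom_apply]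

variable [IsAlgClosed A]

theorem MulRingSeminorm.map_eq_prod_aroots (y : MulRingSeminorm A[X]) (hy : ∀ a, y (C a) = v a)
    (f : k[X]) : y (f.map (algebraMap k A)) = v (algebraMap k A f.leadingCoeff) *
      ((f.aroots A).map fun β => y (X - C β)).prod := by
  conv_lhs => rw [(IsAlgClosed.splits (f.map (algebraMap k A))).eq_prod_roots]
  rw [map_mul, hy, leadingCoeff_map, map_multiset_prod, Multiset.map_map]
  rfl

theorem MulRingSeminorm.map_eq_prod_aroots_of_monic (y : MulRingSeminorm A[X])
    (hy : ∀ a, y (C a) = v a) {f : k[X]} (hf : f.Monic) :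
    y (f.map (algebraMap k A)) = ((f.aroots A).map fun β => y (X - C β)).prod := by
  rw [y.map_eq_prod_aroots hy, hf.leadingCoeff, map_one, map_one, one_mul]

theorem AbsoluteValue.map_aeval_eq_prod_aroots {f : k[X]} (hf : f.Monic) (a : A) :
    v (aeval a f) = ((f.aroots A).map fun β => v (a - β)).prod := by
  have := (v.pullback (evalRingHom a)).map_eq_prod_aroots_of_monic (v := v) (fun b => by simp) hf
  simpa [eval_map_algebraMap] using this

/-- If `P` has the smallest value relative to its degree among the polynomials of degree at
most `d`, then no algebraic element of degree at most `d` is closer than the roots of `P`. -/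
theorem MulRingSeminorm.map_X_sub_C_le_of_forall_pow_le [Normal k A]
    (hσ : ∀ (σ : A ≃ₐ[k] A) a, v (σ a) = v a) {y : MulRingSeminorm A[X]}
    (hna : IsNonarchimedean y) (hy : ∀ a, y (C a) = v a) {d : ℕ} {P : k[X]} (hPm : P.Monic)
    (hP : Irreducible P)
    (hmin : ∀ Q : k[X], Q.Monic → 0 < Q.natDegree → Q.natDegree ≤ d →
      y (P.map (algebraMap k A)) ^ Q.natDegree ≤ y (Q.map (algebraMap k A)) ^ P.natDegree)
    {α : A} (hα : α ∈ P.aroots A) (hle : ∀ a ∈ P.aroots A, y (X - C α) ≤ y (X - C a))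
    {β : A} (hβ : (minpoly k β).natDegree ≤ d) : y (X - C α) ≤ y (X - C β) := by
  by_contra! hlt
  have hint : IsIntegral k β := Algebra.IsIntegral.isIntegral β
  set Q := minpoly k β with hQ_def
  have hQm : Q.Monic := minpoly.monic hint
  have hQ : Irreducible Q := minpoly.irreducible hint
  have hβQ : β ∈ Q.aroots A := by
    rw [mem_aroots]
    exact ⟨hQm.ne_zero, minpoly.aeval k β⟩
  have hsub : ∀ a b, v (a - b) ≤ max (y (X - C a)) (y (X - C b)) := fun a b => by
    rw [← hy, show C (a - b) = (X - C b) + -(X - C a) by rw [C_sub]; ring, max_comm,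
      ← map_neg_eq_map y (X - C a)]
    exact hna _ _
  have htri : ∀ a b, y (X - C b) ≤ max (y (X - C a)) (v (a - b)) := fun a b => by
    rw [← hy, show X - C b = (X - C a) + C (a - b) by rw [C_sub]; ring]
    exact hna _ _
  -- With `β` nearer than every root of `P`, these roots do not distinguish `y` from `β`.
  have hroot : ∀ a ∈ P.aroots A, y (X - C a) = v (β - a) := fun a ha => by
    have hlt' := hlt.trans_le (hle a ha)
    have h1 := hsub β a
    rw [max_eq_right hlt'.le] at h1
    exact le_antisymm ((le_max_iff.1 (htri β a)).resolve_left hlt'.not_ge) h1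
  -- A conjugate `b` violating this would satisfy `v (α - b) < y (X - C α)`; moving `b` to `β` moves
  -- `α` to a root of `P` nearer than `α`.
  have hconj : ∀ b ∈ Q.aroots A, y (X - C b) ≤ v (α - b) := fun b hb => by
    by_contra! h
    have h1 : y (X - C b) ≤ y (X - C α) := (le_max_iff.1 (htri α b)).resolve_right h.not_ge
    obtain ⟨σ, hσb⟩ := hQ.exists_algEquiv_eq hb hβQ
    have h2 := σ.map_mem_aroots hα
    have h3 := hle _ h2
    rw [hroot _ h2, ← hσb, ← map_sub, hσ, v.map_sub] at h3
    linarith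
  have hαpos : 0 < y (X - C α) := (apply_nonneg y _).trans_lt hlt
  have hαβ : v (α - β) = y (X - C α) := by rw [hroot α hα, v.map_sub]
  have hpos : ∀ b ∈ Q.aroots A, 0 < v (α - b) := fun b hb => by
    refine v.pos fun h => ?_
    have hb' : y (X - C b) = 0 := le_antisymm ((hconj b hb).trans (by rw [h, map_zero]))
      (apply_nonneg y _)
    rw [← sub_eq_zero.1 h] at hb'
    exact hαpos.ne' hb'
  have hlt1 : y (Q.map (algebraMap k A)) < v (aeval α Q) := by
    rw [y.map_eq_prod_aroots_of_monic hy hQm, AbsoluteValue.map_aeval_eq_prod_aroots hQm]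
    exact Multiset.prod_map_lt_prod_map_of_exists (fun _ _ => apply_nonneg y _) hconj hpos
      ⟨β, hβQ, by rwa [hαβ]⟩
  have hPβ : y (P.map (algebraMap k A)) = v (aeval β P) := by
    rw [y.map_eq_prod_aroots_of_monic hy hPm, AbsoluteValue.map_aeval_eq_prod_aroots hPm]
    exact congrArg _ (Multiset.map_congr rfl hroot)
  -- Both sides are the absolute value of the resultant of `P` and `Q`, as a product over pairs of
  -- roots; conjugate roots contribute equally.
  have hres : v (aeval β P) ^ Q.natDegree = v (aeval α Q) ^ P.natDegree := by
    have h1 : ((Q.aroots A).map fun b => v (aeval b P)).prod = v (aeval β P) ^ Q.natDegree := by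
      rw [Multiset.map_congr rfl fun b hb =>
        AbsoluteValue.map_aeval_eq_of_mem_aroots hσ hQ hb hβQ P, Multiset.map_const',
        Multiset.prod_replicate, IsAlgClosed.card_aroots_eq_natDegree]
    have h2 : ((P.aroots A).map fun a => v (aeval a Q)).prod = v (aeval α Q) ^ P.natDegree := by
      rw [Multiset.map_congr rfl fun a ha =>
        AbsoluteValue.map_aeval_eq_of_mem_aroots hσ hP ha hα Q, Multiset.map_const',
        Multiset.prod_replicate, IsAlgClosed.card_aroots_eq_natDegree]
    rw [← h1, ← h2]
    simp only [AbsoluteValue.map_aeval_eq_prod_aroots hPm,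
      AbsoluteValue.map_aeval_eq_prod_aroots hQm]
    rw [Multiset.prod_map_prod_map]
    simp only [v.map_sub]
  have h1 := hmin Q hQm (minpoly.natDegree_pos hint) hβ
  rw [hPβ, hres] at h1
  exact absurd h1 (pow_lt_pow_left₀ hlt1 (apply_nonneg y _) hP.natDegree_pos.ne').not_ge

end Roots

/-! ### Points defined by discs. -/

section Gauss

theorem Polynomial.gaussNorm_congr {R : Type*} [Ring R] {v : AbsoluteValue R ℝ} {c : ℝ}
    (hc : 0 ≤ c) {p q : R[X]} (h : ∀ i, v (p.coeff i) = v (q.coeff i)) :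
    p.gaussNorm v c = q.gaussNorm v c := by
  refine le_antisymm ?_ ?_
  · obtain ⟨i, hi⟩ := exists_eq_gaussNorm v c p
    rw [hi, h]
    exact le_gaussNorm v q hc i
  · obtain ⟨i, hi⟩ := exists_eq_gaussNorm v c q
    rw [hi, ← h]
    exact le_gaussNorm v p hc i

variable {A : Type*} [Field A] {v : AbsoluteValue A ℝ}

/-- The point of the line over `A` given by the disc of center `α` and radius `δ`. -/
noncomputable def AbsoluteValue.discSeminorm (v : AbsoluteValue A ℝ) (hv : IsNonarchimedean v)
    (α : A) {δ : ℝ} (hδ : 0 < δ) : MulRingSeminorm A[X] where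
  toFun f := (taylor α f).gaussNorm v δ
  map_zero' := by simp
  add_le' f g := by
    rw [map_add]
    exact (isNonarchimedean_gaussNorm v hv hδ.le).add_le (gaussNorm_nonneg v · hδ.le)
  neg' f := gaussNorm_congr hδ.le fun i => by simp
  map_one' := by rw [taylor_one, gaussNorm_C, map_one]
  map_mul' f g := by rw [taylor_mul, gaussNorm_mul hv hδ]

theorem AbsoluteValue.discSeminorm_apply (hv : IsNonarchimedean v) (α : A) {δ : ℝ} (hδ : 0 < δ)
    (f : A[X]) : v.discSeminorm hv α hδ f = (taylor α f).gaussNorm v δ := rfl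

theorem AbsoluteValue.discSeminorm_C (hv : IsNonarchimedean v) (α : A) {δ : ℝ} (hδ : 0 < δ)
    (a : A) : v.discSeminorm hv α hδ (C a) = v a := by
  rw [discSeminorm_apply, taylor_C, gaussNorm_C]

theorem AbsoluteValue.discSeminorm_X_sub_C (hv : IsNonarchimedean v) (α : A) {δ : ℝ} (hδ : 0 < δ)
    (β : A) : v.discSeminorm hv α hδ (X - C β) = max δ (v (α - β)) := by
  have e : taylor α (X - C β) = X + C (α - β) := by
    rw [map_sub, taylor_X, taylor_C, C_sub]
    ring
  rw [discSeminorm_apply, e]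
  refine le_antisymm ?_ (max_le ?_ ?_)
  · refine (isNonarchimedean_gaussNorm v hv hδ.le _ _).trans_eq ?_
    rw [gaussNorm_C, ← monomial_one_one_eq_X, gaussNorm_monomial, map_one, one_mul, pow_one]
  · have := le_gaussNorm v (X + C (α - β)) hδ.le 1
    rwa [coeff_add, coeff_X_one, coeff_C_of_ne_zero one_ne_zero, add_zero, map_one, one_mul,
      pow_one] at this
  · have := le_gaussNorm v (X + C (α - β)) hδ.le 0
    rwa [coeff_add, coeff_X_zero, coeff_C_zero, zero_add, pow_zero, mul_one] at this

/-- In the Taylor expansion at `α`, the ultrametric inequality bounds `y f` by a single term, which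
the Gauss norm dominates. -/
theorem AbsoluteValue.le_discSeminorm (hv : IsNonarchimedean v) (α : A) {δ : ℝ} (hδ : 0 < δ)
    {y : MulRingSeminorm A[X]} (hna : IsNonarchimedean y) (hy : ∀ a, y (C a) = v a)
    (hle : y (X - C α) ≤ δ) (f : A[X]) : y f ≤ v.discSeminorm hv α hδ f := by
  conv_lhs => rw [← sum_taylor_eq f α]
  rw [Polynomial.sum]
  obtain ⟨i, -, hi⟩ := IsNonarchimedean.finset_image_add (map_zero y) (apply_nonneg y) hna
    (fun i => C ((taylor α f).coeff i) * (X - C α) ^ i) (taylor α f).support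
  refine hi.trans ?_
  rw [map_mul, map_pow, hy]
  refine le_trans ?_ (le_gaussNorm v (taylor α f) hδ.le i)
  gcongr

/-- The Taylor coefficients at `σ α` are the images under `σ` of those at `α`. Over `k`, the center
of a disc therefore matters only up to conjugacy. -/
theorem AbsoluteValue.discSeminorm_map_algEquiv {k : Type*} [Field k] [Algebra k A]
    (hv : IsNonarchimedean v) (hσ : ∀ (σ : A ≃ₐ[k] A) a, v (σ a) = v a) (σ : A ≃ₐ[k] A) (α : A)
    {δ : ℝ} (hδ : 0 < δ) (f : k[X]) :
    v.discSeminorm hv (σ α) hδ (f.map (algebraMap k A)) =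
      v.discSeminorm hv α hδ (f.map (algebraMap k A)) := by
  refine gaussNorm_congr hδ.le fun i => ?_
  have e : taylor (σ α) (f.map (algebraMap k A)) =
      (taylor α (f.map (algebraMap k A))).map (σ : A →+* A) := by
    rw [map_taylor, map_map]
    congr 2
    ext a
    simp
  rw [e, coeff_map]
  exact hσ σ _

end Gauss

/-! ### Construction of the approximating point. -/

/-- For every `x` and `d ≥ 1` there is a point that agrees with `x` up to degree `d` and is either
a zero of some irreducible polynomial `P` of degree at most `d`, or the largest point of a set
`{|P| ≤ r}`. -/
theorem MaximallyComplete.exists_agree_maximal {k : Type u} [NormedField k] [IsUltrametricDist k]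
    [CompleteSpace k] (hk : MaximallyComplete k) (x : MulRingSeminorm k[X])
    (hx : ∀ a, x (C a) = ‖a‖) {d : ℕ} (hd : 1 ≤ d) :
    ∃ P : k[X], Irreducible P ∧ P.natDegree ≤ d ∧ ∃ z : MulRingSeminorm k[X],
      (∀ f : k[X], f.natDegree ≤ d → z f = x f) ∧ (z P = 0 ∨ 0 < z P ∧
        ∀ y : MulRingSeminorm k[X], (∀ a, y (C a) = ‖a‖) → y P ≤ z P → ∀ f, y f ≤ z f) := by
  obtain ⟨P, hPm, hP, hPd, hmin⟩ := hk.exists_irreducible_forall_pow_le x hx hd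
  refine ⟨P, hP, hPd, ?_⟩
  rcases (apply_nonneg x P).eq_or_lt with h0 | h0
  · exact ⟨x, fun _ _ => rfl, Or.inl h0.symm⟩
  obtain ⟨v, hv, hvk⟩ := AbsoluteValue.exists_extends k (AlgebraicClosure k)
  have hσ : ∀ (σ : AlgebraicClosure k ≃ₐ[k] AlgebraicClosure k) a, v (σ a) = v a := fun σ a =>
    have := AbsoluteValue.eq_of_extends (K := k)
      (v.comp (f := σ.toRingEquiv.toRingHom) σ.injective) v
      (fun a b => by
        have := hv (σ a) (σ b)
        rwa [← map_add] at this) hv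
      (fun a => by
        change v (σ (algebraMap k _ a)) = ‖a‖
        rw [σ.commutes, hvk]) hvk
    congrArg (fun w : AbsoluteValue (AlgebraicClosure k) ℝ => w a) this
  have hnear : ∀ y : MulRingSeminorm (AlgebraicClosure k)[X], ∃ α ∈ P.aroots (AlgebraicClosure k),
      ∀ a ∈ P.aroots (AlgebraicClosure k), y (X - C α) ≤ y (X - C a) := fun y => by
    classical
    obtain ⟨α, hα, h⟩ := Finset.exists_min_image (P.aroots (AlgebraicClosure k)).toFinset
      (fun a => y (X - C a)) (by
        rw [Multiset.toFinset_nonempty, ← Multiset.card_pos, IsAlgClosed.card_aroots_eq_natDegree]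
        exact hP.natDegree_pos)
    exact ⟨α, Multiset.mem_toFinset.1 hα, fun a ha => h a (Multiset.mem_toFinset.2 ha)⟩
  obtain ⟨x', hx'na, hx'C, hx'⟩ := x.exists_extends v hv hvk hx
  obtain ⟨α, hα, hαle⟩ := hnear x'
  have hclose : ∀ β, (minpoly k β).natDegree ≤ d → x' (X - C α) ≤ x' (X - C β) := fun β hβ =>
    MulRingSeminorm.map_X_sub_C_le_of_forall_pow_le hσ hx'na hx'C hPm hP
      (fun Q h1 h2 h3 => by rw [hx', hx']; exact hmin Q h1 h2 h3) hα hαle hβ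
  set δ := x' (X - C α) with hδ_def
  have hδ : 0 < δ := by
    refine lt_of_le_of_ne (apply_nonneg x' _) fun h => h0.ne ?_
    rw [← hx' P, x'.map_eq_prod_aroots_of_monic hx'C hPm, eq_comm, Multiset.prod_eq_zero_iff]
    exact Multiset.mem_map.2 ⟨α, hα, h.symm⟩
  let ζ := v.discSeminorm hv α hδ
  have hζC : ∀ a, ζ (C a) = v a := v.discSeminorm_C hv α hδ
  let z : MulRingSeminorm k[X] :=
    { toFun := fun f => ζ (f.map (algebraMap k _))
      map_zero' := by simp
      add_le' := fun f g => by rw [Polynomial.map_add]; exact map_add_le_add ζ _ _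
      neg' := fun f => by rw [Polynomial.map_neg, map_neg_eq_map]
      map_one' := by simp
      map_mul' := fun f g => by rw [Polynomial.map_mul, map_mul] }
  have hz : ∀ f, z f = ζ (f.map (algebraMap k _)) := fun f => rfl
  have hagree : ∀ f : k[X], f.natDegree ≤ d → z f = x f := fun f hf => by
    rw [hz, ← hx', ζ.map_eq_prod_aroots hζC, x'.map_eq_prod_aroots hx'C]
    congr 2
    refine Multiset.map_congr rfl fun β hβ => ?_
    rw [mem_aroots] at hβ
    -- Every root of `f` has degree at most `d`, so it is no nearer to `x'` than `α`; the
    -- ultrametric inequality then determines its distance to `x'`.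
    have hβd : x' (X - C α) ≤ x' (X - C β) :=
      hclose β ((natDegree_le_of_dvd (minpoly.dvd k β hβ.2) hβ.1).trans hf)
    have h1 : x' (X - C β) ≤ max δ (v (α - β)) := by
      rw [← hx'C, show X - C β = (X - C α) + C (α - β) by rw [C_sub]; ring]
      exact hx'na _ _
    have h2 : v (α - β) ≤ x' (X - C β) := by
      rw [← hx'C, show C (α - β) = (X - C β) + -(X - C α) by rw [C_sub]; ring]
      refine (hx'na _ _).trans (max_le le_rfl ?_)
      rwa [map_neg_eq_map]
    rw [v.discSeminorm_X_sub_C]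
    exact le_antisymm (max_le hβd h2) h1
  refine ⟨z, hagree, Or.inr ⟨by rwa [hagree P hPd], fun y hyC hyP f => ?_⟩⟩
  obtain ⟨y', hy'na, hy'C, hy'⟩ := y.exists_extends v hv hvk hyC
  obtain ⟨α', hα', hα'le⟩ := hnear y'
  -- The disc is recentered at the root nearest to `y'`, which does not change `z`.
  obtain ⟨σ, rfl⟩ := hP.exists_algEquiv_eq hα hα'
  have hzσ : ∀ f, z f = v.discSeminorm hv (σ α) hδ (f.map (algebraMap k _)) := fun f =>
    (v.discSeminorm_map_algEquiv hv hσ σ α hδ f).symm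
  have hle : y' (X - C (σ α)) ≤ δ := by
    -- If `y'` were outside the disc, it would be at least as far as the disc point from every root
    -- of `P` and strictly farther from `σ α`, hence `|P(y)| > |P(z)|`.
    by_contra! hlt
    refine hyP.not_gt ?_
    rw [hzσ, ← hy', (v.discSeminorm hv (σ α) hδ).map_eq_prod_aroots_of_monic
      (v.discSeminorm_C hv _ hδ) hPm, y'.map_eq_prod_aroots_of_monic hy'C hPm]
    refine Multiset.prod_map_lt_prod_map_of_exists (fun _ _ => apply_nonneg _ _) (fun a ha => ?_)
      (fun a ha => hδ.trans (hlt.trans_le (hα'le a ha))) ⟨σ α, hα', ?_⟩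
    · rw [v.discSeminorm_X_sub_C]
      refine max_le (hlt.le.trans (hα'le a ha)) ?_
      rw [← hy'C, show C (σ α - a) = (X - C a) + -(X - C (σ α)) by rw [C_sub]; ring]
      refine (hy'na _ _).trans (max_le le_rfl ?_)
      rw [map_neg_eq_map]
      exact hα'le a ha
    · rw [v.discSeminorm_X_sub_C, sub_self, map_zero, max_eq_left hδ.le]
      exact hlt
  rw [hzσ, ← hy']
  exact v.le_discSeminorm hv _ hδ hy'na hy'C hle _

/-! ### Shilov boundaries, the sets `D_d` and the inverse limit. -/

namespace BerkovichLine

variable {k : Type u} [NormedField k]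

theorem absAt_C (x : BerkovichLine k) (a : k) : absAt (C a) x = ‖a‖ := x.map_C' a

theorem absAt_nonneg (x : BerkovichLine k) (P : k[X]) : 0 ≤ absAt P x := apply_nonneg _ _

theorem absAt_mul (x : BerkovichLine k) (P Q : k[X]) :
    absAt (P * Q) x = absAt P x * absAt Q x := map_mul x.toMulRingSeminorm P Q

theorem ext_absAt {x y : BerkovichLine k} (h : ∀ P, absAt P x = absAt P y) : x = y := by
  obtain ⟨x, hx⟩ := x
  obtain ⟨y, hy⟩ := y
  have : x = y := MulRingSeminorm.ext h
  subst this
  rfl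

theorem isClosed_singleton (x : BerkovichLine k) : IsClosed {x} := by
  have hind : Topology.IsInducing fun (x : BerkovichLine k) (P : k[X]) => absAt P x := ⟨rfl⟩
  have : ({x} : Set (BerkovichLine k)) =
      (fun (x : BerkovichLine k) (P : k[X]) => absAt P x) ⁻¹' {fun P => absAt P x} := by
    ext y
    simp only [Set.mem_singleton_iff, Set.mem_preimage]
    exact ⟨fun h => by rw [h], fun h => ext_absAt fun P => congrFun h P⟩
  rw [this]
  exact _root_.isClosed_singleton.preimage hind.continuous

/-- The value of a polynomial at a largest point of a set is reached on every boundary, and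
finitely many values are reached simultaneously. -/
theorem IsBoundary.mem_of_forall_le {V S : Set (BerkovichLine k)} (hS : IsBoundary V S)
    {x : BerkovichLine k} (hxV : x ∈ V) (hx : ∀ y ∈ V, ∀ f, absAt f y ≤ absAt f x) : x ∈ S := by
  classical
  have hfin : ∀ I : Finset k[X], ∃ z ∈ S, ∀ f ∈ I, absAt f z = absAt f x := fun I => by
    -- Since no factor exceeds its value at `x`, maximizing the product maximizes every factor.
    -- Polynomials vanishing at `x` are left out to keep the product nonzero.
    obtain ⟨z, hz, hle⟩ := hS.2.2 (∏ f ∈ I with absAt f x ≠ 0, f) x hxV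
    refine ⟨z, hz, fun f hf => le_antisymm (hx z (hS.2.1 hz) f) ?_⟩
    by_cases h0 : absAt f x = 0
    · rw [h0]
      exact absAt_nonneg z f
    have hprod : ∀ y : BerkovichLine k, absAt (∏ f ∈ I with absAt f x ≠ 0, f) y =
        ∏ f ∈ I with absAt f x ≠ 0, absAt f y := fun y => map_prod y.toMulRingSeminorm _ _
    by_contra! hlt
    rw [hprod, hprod] at hle
    have hmem : f ∈ I.filter fun f => absAt f x ≠ 0 := Finset.mem_filter.2 ⟨hf, h0⟩
    refine hle.not_gt ?_
    exact Multiset.prod_map_lt_prod_map_of_exists (fun g _ => absAt_nonneg z g)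
      (fun g _ => hx z (hS.2.1 hz) g)
      (fun g hg => (absAt_nonneg x g).lt_of_ne' (Finset.mem_filter.1 hg).2) ⟨f, hmem, hlt⟩
  choose z hzS hz using hfin
  -- Along growing finite sets of polynomials, the points `z I` converge pointwise to `x`, and `S`
  -- is closed.
  refine hS.1.mem_of_tendsto (f := z) (b := Filter.atTop) ?_ (Filter.Eventually.of_forall hzS)
  have hind : Topology.IsInducing fun (x : BerkovichLine k) (P : k[X]) => absAt P x := ⟨rfl⟩
  rw [hind.tendsto_nhds_iff, tendsto_pi_nhds]
  refine fun f => tendsto_const_nhds.congr' ?_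
  filter_upwards [Filter.eventually_ge_atTop {f}] with I hI
  exact (hz I f (hI (Finset.mem_singleton_self f))).symm

theorem isShilovBoundary_singleton_iff {V : Set (BerkovichLine k)} {x : BerkovichLine k} :
    IsShilovBoundary V {x} ↔ x ∈ V ∧ ∀ y ∈ V, ∀ f, absAt f y ≤ absAt f x := by
  refine ⟨fun h => ⟨h.1.2.1 rfl, fun y hy f => ?_⟩, fun h => ⟨⟨isClosed_singleton x, ?_, ?_⟩, ?_⟩⟩
  · obtain ⟨z, rfl, hz⟩ := h.1.2.2 f y hy
    exact hz
  · exact Set.singleton_subset_iff.2 h.1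
  · exact fun f y hy => ⟨x, rfl, h.2 y hy f⟩
  · exact fun S hS => Set.singleton_subset_iff.2 (hS.mem_of_forall_le h.1 h.2)

/-- Two points that vanish at `P` and agree on polynomials of smaller degree are equal. -/
theorem eq_of_absAt_eq_zero {P : k[X]} (hP : P ≠ 0) {x y : BerkovichLine k} (hx : absAt P x = 0)
    (hy : absAt P y = 0) (h : ∀ f : k[X], f.natDegree ≤ P.natDegree → absAt f x = absAt f y) :
    x = y := by
  have key : ∀ (x : BerkovichLine k), absAt P x = 0 → ∀ f, absAt f x = absAt (f % P) x := by
    intro x hx f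
    have hd : absAt (P * (f / P)) x = 0 := by rw [absAt_mul, hx, zero_mul]
    have e := EuclideanDomain.div_add_mod f P
    refine le_antisymm ?_ ?_
    · have := map_add_le_add x.toMulRingSeminorm (P * (f / P)) (f % P)
      rw [e] at this
      change absAt f x ≤ absAt (P * (f / P)) x + _ at this
      rwa [hd, zero_add] at this
    · have := map_sub_le_add x.toMulRingSeminorm f (P * (f / P))
      rw [← eq_sub_of_add_eq' e] at this
      change _ ≤ _ + absAt (P * (f / P)) x at this
      rwa [hd, add_zero] at this
  refine ext_absAt fun f => ?_
  rw [key x hx, key y hy]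
  exact h _ (natDegree_le_natDegree (degree_mod_lt f hP).le)

theorem IsEta.absAt_le {P : k[X]} {r : ℝ} {x y : BerkovichLine k} (h : IsEta P r x)
    (h0 : absAt P x ≠ 0) (hy : absAt P y ≤ absAt P x) (f : k[X]) : absAt f y ≤ absAt f x := by
  rcases h with ⟨-, h⟩ | ⟨-, h⟩
  · exact absurd h h0
  · rw [isShilovBoundary_singleton_iff] at h
    exact h.2 y (hy.trans h.1) f

/-- If neither defining polynomial vanishes, each point lies in the set of which the other is the
largest point, so each dominates the other. If one vanishes, it vanishes at both points, and
remainders modulo it determine all values. -/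
theorem eq_of_mem_D {d : ℕ} {x y : BerkovichLine k} (hx : x ∈ D k d) (hy : y ∈ D k d)
    (h : AgreeUpTo d x y) : x = y := by
  cases d with
  | zero =>
    obtain ⟨h0, -⟩ | ⟨-, hx⟩ := hx
    · exact absurd h0 one_ne_zero
    obtain ⟨h0, -⟩ | ⟨-, hy⟩ := hy
    · exact absurd h0 one_ne_zero
    exact Set.singleton_injective (hx.unique hy)
  | succ d =>
    obtain ⟨P, hP, hPd, r, -, hPx⟩ := hx
    obtain ⟨Q, hQ, hQd, s, -, hQy⟩ := hy
    have hPe := h P hPd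
    have hQe := h Q hQd
    by_cases hP0 : absAt P x = 0
    · exact eq_of_absAt_eq_zero hP.ne_zero hP0 (hPe.trans hP0)
        fun f hf => (h f (hf.trans hPd)).symm
    by_cases hQ0 : absAt Q x = 0
    · exact eq_of_absAt_eq_zero hQ.ne_zero hQ0 (hQe.trans hQ0)
        fun f hf => (h f (hf.trans hQd)).symm
    exact ext_absAt fun f => le_antisymm (hQy.absAt_le (hQe ▸ hQ0) hQe.ge f)
      (hPx.absAt_le hP0 hPe.le f)

/-- The Gauss point is the largest point of the closed unit disc. -/
theorem exists_isEta_X_one [IsUltrametricDist k] : ∃ x : BerkovichLine k, IsEta X 1 x := by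
  have hv : IsNonarchimedean (NormedField.toAbsoluteValue k) := fun a b =>
    IsUltrametricDist.norm_add_le_max a b
  let x : BerkovichLine k :=
    ⟨(NormedField.toAbsoluteValue k).discSeminorm hv 0 one_pos,
      AbsoluteValue.discSeminorm_C hv 0 one_pos⟩
  refine ⟨x, Or.inr ⟨one_pos, isShilovBoundary_singleton_iff.2 ⟨?_, fun y hy f => ?_⟩⟩⟩
  · have := AbsoluteValue.discSeminorm_X_sub_C hv (0 : k) one_pos 0
    rw [C_0, sub_zero, sub_zero, map_zero, max_eq_left zero_le_one] at this
    exact this.le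
  · refine AbsoluteValue.le_discSeminorm hv 0 one_pos
      (y.toMulRingSeminorm.isNonarchimedean_of_map_C y.map_C') y.map_C' ?_ f
    rw [C_0, sub_zero]
    exact hy

theorem exists_agreeUpTo [IsUltrametricDist k] [CompleteSpace k] (hk : MaximallyComplete k)
    (d : ℕ) (x : BerkovichLine k) : ∃ y ∈ D k d, AgreeUpTo d x y := by
  cases d with
  | zero =>
    obtain ⟨y, hy⟩ := exists_isEta_X_one (k := k)
    refine ⟨y, hy, fun P hP => ?_⟩
    rw [eq_C_of_natDegree_le_zero hP, absAt_C, absAt_C]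
  | succ d =>
    obtain ⟨P, hP, hPd, z, hz, h⟩ :=
      hk.exists_agree_maximal x.toMulRingSeminorm x.map_C' d.succ_pos
    let y : BerkovichLine k := ⟨z, fun a => (hz (C a) (by simp)).trans (x.map_C' a)⟩
    refine ⟨y, ⟨P, hP, hPd, ?_⟩, hz⟩
    rcases h with h | ⟨h0, h⟩
    · exact ⟨0, le_rfl, Or.inl ⟨rfl, h⟩⟩
    · exact ⟨z P, h0.le, Or.inr ⟨h0, isShilovBoundary_singleton_iff.2
        ⟨le_refl (z P), fun w hw => h w.toMulRingSeminorm w.map_C' hw⟩⟩⟩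

/-- A compatible family of points defines a point that agrees with all of them. -/
theorem exists_forall_agreeUpTo (y : ℕ → BerkovichLine k)
    (hy : ∀ d d', d ≤ d' → AgreeUpTo d (y d') (y d)) :
    ∃ x : BerkovichLine k, ∀ d, AgreeUpTo d x (y d) := by
  have hval : ∀ (f : k[X]) d, f.natDegree ≤ d → absAt f (y f.natDegree) = absAt f (y d) :=
    fun f d hd => hy _ _ hd f le_rfl
  have key : ∀ f g : k[X], ∃ x : BerkovichLine k, absAt f (y f.natDegree) = absAt f x ∧
      absAt g (y g.natDegree) = absAt g x ∧
      absAt (f + g) (y (f + g).natDegree) = absAt (f + g) x ∧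
      absAt (f * g) (y (f * g).natDegree) = absAt (f * g) x := fun f g =>
    -- A single index large enough for `f`, `g`, their sum and their product, so that the axioms are
    -- inherited from one actual point.
    ⟨y (f.natDegree + g.natDegree), hval _ _ (by omega), hval _ _ (by omega),
      hval _ _ ((natDegree_add_le f g).trans (by omega)), hval _ _ natDegree_mul_le⟩
  refine ⟨⟨{ toFun := fun f => absAt f (y f.natDegree)
             map_zero' := map_zero (y _).toMulRingSeminorm
             add_le' := fun f g => by
               obtain ⟨x, hf, hg, hfg, -⟩ := key f g
               rw [hf, hg, hfg]
               exact map_add_le_add x.toMulRingSeminorm f g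
             neg' := fun f => by
               rw [natDegree_neg]
               exact map_neg_eq_map (y _).toMulRingSeminorm f
             map_one' := map_one (y _).toMulRingSeminorm
             map_mul' := fun f g => by
               obtain ⟨x, hf, hg, -, hfg⟩ := key f g
               rw [hf, hg, hfg, absAt_mul] }, fun a => absAt_C _ a⟩, fun d f hf => ?_⟩
  exact (hval f d hf).symm

end BerkovichLine

/-- For `k` maximally complete, every point `x` of the Berkovich line has, for each `d`, a unique
`x_d = approx d x` in `D_d` with `|P(x_d)| = |P(x)|` for all `P` of degree at most `d`, and
`x ↦ (x_d)_d` is a bijection onto the inverse limit of the `D_d`, taken along the transition maps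
`D_d' → D_d`, `y ↦ y_d`, for `d ≤ d'`. -/
theorem corollary1 (k : Type u) [NormedField k] [IsUltrametricDist k] [CompleteSpace k]
    (hk : MaximallyComplete k) :
    ∃ approx : ∀ d : ℕ, BerkovichLine k → BerkovichLine.D k d,
      (∀ (d : ℕ) (x : BerkovichLine k) (y : BerkovichLine.D k d),
        y = approx d x ↔ BerkovichLine.AgreeUpTo d x y) ∧
      Set.BijOn (fun (x : BerkovichLine k) (d : ℕ) => approx d x) Set.univ
        {y : ∀ d : ℕ, BerkovichLine.D k d | ∀ d d' : ℕ, d ≤ d' → approx d (y d') = y d} := by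
  choose approx hmem hagree using fun d x => BerkovichLine.exists_agreeUpTo hk d x
  have huniq : ∀ (d : ℕ) (x : BerkovichLine k) (y : BerkovichLine.D k d),
      y = ⟨approx d x, hmem d x⟩ ↔ BerkovichLine.AgreeUpTo d x y := fun d x y => by
    refine ⟨fun h => h ▸ hagree d x, fun h => Subtype.ext (BerkovichLine.eq_of_mem_D y.2 (hmem d x)
      fun P hP => (hagree d x P hP).trans (h P hP).symm)⟩
  refine ⟨fun d x => ⟨approx d x, hmem d x⟩, huniq, fun x _ d d' hd => ?_, fun x _ y _ h => ?_,
    fun y hy => ?_⟩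
  · exact ((huniq d _ _).2 fun P hP =>
      (hagree d x P hP).trans (hagree d' x P (hP.trans hd)).symm).symm
  · refine BerkovichLine.ext_absAt fun P => ?_
    have hd := congrArg Subtype.val (congrFun h P.natDegree)
    rw [← hagree P.natDegree x P le_rfl, ← hagree P.natDegree y P le_rfl]
    exact congrArg _ hd
  · obtain ⟨x, hx⟩ := BerkovichLine.exists_forall_agreeUpTo (fun d => (y d : BerkovichLine k))
      fun d d' hd => (huniq d _ _).1 (hy d d' hd).symm
    exact ⟨x, Set.mem_univ x, funext fun d => ((huniq d x (y d)).2 (hx d)).symm⟩
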